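/- For an integer $n \ge 0$ let $\mathcal{M}_{2n}$ be the Maiorana--McFarland class, i.e. the set of all Boolean functions $f : \mathbb{F}_2^{2n} \to \mathbb{F}_2$ of the form $f(x,y) = \langle x, \pi(y)\rangle + \varphi(y)$, $x, y \in \mathbb{F}_2^n$, where $\pi$ is a permutation of $\mathbb{F}_2^n$, $\varphi : \mathbb{F}_2^n \to \mathbb{F}_2$ is arbitrary and $\langle x, y\rangle = x_1y_1 + \dots + x_ny_n$. Let $\mathcal{M}^{\#}_{2n}$ be its closure under extended-affine equivalence, i.e. the set of all functions $x \mapsto f(A(x)) + h(x)$ with $f \in \mathcal{M}_{2n}$, $A$ an invertible affine transformation of $\mathbb{F}_2^{2n}$ and $h : \mathbb{F}_2^{2n} \to \mathbb{F}_2$ affine. Let $$\binom{2n}{n}_2 = \prod_{i=0}^{n-1} \frac{2^{2n} - 2^i}{2^n - 2^i}$$ be the Gaussian binomial coefficient. Then $|\mathcal{M}^{\#}_{2n}| \le \binom{2n}{n}_2 |\mathcal{M}_{2n}|$ for every $n$, and, as $n \to \infty$, $$|\mathcal{M}^{\#}_{2n}| = \binom{2n}{n}_2\, |\mathcal{M}_{2n}|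 - o\big((2^n)!\big).$$ In particular the upper bound is asymptotically tight: $|\mathcal{M}^{\#}_{2n}| \big/ \big(\binom{2n}{n}_2 |\mathcal{M}_{2n}|\big) \to 1$ as $n \to \infty$. -/

import Mathlib

namespace MaioranaMcFarland

/-- The vector space `𝔽₂ᵐ`. -/
abbrev BVec (m : ℕ) : Type := Fin m → ZMod 2

/-- Boolean functions in `m` variables. -/
abbrev BoolFun (m : ℕ) : Type := BVec m → ZMod 2

/-- The component `x ∈ 𝔽₂ⁿ` of `(x, y) ∈ 𝔽₂²ⁿ` (the first `n` coordinates). -/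
def firstHalf {n : ℕ} (z : BVec (n + n)) : BVec n := fun i => z (Fin.castAdd n i)

/-- The component `y ∈ 𝔽₂ⁿ` of `(x, y) ∈ 𝔽₂²ⁿ` (the last `n` coordinates). -/
def secondHalf {n : ℕ} (z : BVec (n + n)) : BVec n := fun i => z (Fin.natAdd n i)

/-- The Maiorana--McFarland class in `2n` variables: all functions
`(x, y) ↦ ⟨x, π(y)⟩ + φ(y)` with `π` a permutation of `𝔽₂ⁿ` and `φ` a Boolean function
in `n` variables. -/
def MF (n : ℕ) : Set (BoolFun (n + n)) :=
  {f | ∃ (π : Equiv.Perm (BVec n)) (φ : BoolFun n),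
    ∀ z, f z = firstHalf z ⬝ᵥ π (secondHalf z) + φ (secondHalf z)}

/-- Extended-affine equivalence: `g = f ∘ A + h` with `A` an invertible affine
transformation and `h` an affine Boolean function. -/
def EAEquiv {m : ℕ} (f g : BoolFun m) : Prop :=
  ∃ (A : BVec m ≃ᵃ[ZMod 2] BVec m) (h : BVec m →ᵃ[ZMod 2] ZMod 2),
    ∀ x, g x = f (A x) + h x

/-- The completed Maiorana--McFarland class in `2n` variables: the closure of `MF n` under
extended-affine equivalence. -/
def MFC (n : ℕ) : Set (BoolFun (n + n)) :=
  {g | ∃ f ∈ MF n, EAEquiv f g}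

/-- The Gaussian binomial coefficient `[n choose k]₂ = ∏_{i < k} (2ⁿ - 2ⁱ) / (2ᵏ - 2ⁱ)`
(which vanishes for `k > n`, because of the factor `i = n`). -/
noncomputable def gaussBinom (n k : ℕ) : ℝ :=
  ∏ i ∈ Finset.range k, ((2 : ℝ) ^ n - 2 ^ i) / (2 ^ k - 2 ^ i)

end MaioranaMcFarland

namespace MaioranaMcFarland

/-! The class `MF n` is characterised without coordinates by `IsMFWith (stdSub n)`, and
extended-affine maps only move the subspace. Hence `MFC n` is the union over all n-dimensional `V`
of the sets `mfSet V` (`MFC_eq`), each of size `(MF n).ncard`; the union bound gives the upper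
estimate.

For tightness it suffices that pairwise intersections are tiny. Move one subspace to `stdSub n`. If
a function with permutation π is also Maiorana–McFarland for `W ≠ stdSub n`, then π is determined by
its values off a set E of at least 2^(n-2) points (`exists_determining_set`), so at most
(2^n)!/(2^(n-2))! permutations occur, each with at most 2^(2^n) choices of φ. The factorial
(2^(n-2))! beats 2^(2^n) and the squared number of subspaces, so the total overlap is o((2^n)!). -/

/-! ### Maiorana–McFarland functions relative to a subspace -/

/-- `f` is affine on every coset of `V`, with distinct linear parts on distinct cosets. -/
def IsMFWith {m : ℕ} (V : Submodule (ZMod 2) (BVec m)) (f : BoolFun m) : Prop :=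
  (∀ u ∈ V, ∀ v ∈ V, ∀ z, f (z + u + v) - f (z + u) - f (z + v) + f z = 0) ∧
    ∀ z z', (∀ u ∈ V, f (z + u) - f z = f (z' + u) - f z') → z - z' ∈ V

/-- Adding `h` is harmless: its second derivatives vanish, and it shifts the derivative in direction
u by the same constant at every point. -/
lemma IsMFWith.comp_add {m : ℕ} {V : Submodule (ZMod 2) (BVec m)} {f : BoolFun m}
    (hf : IsMFWith V f) (A : BVec m ≃ᵃ[ZMod 2] BVec m) (h : BVec m →ᵃ[ZMod 2] ZMod 2) :
    IsMFWith (V.comap (A.linear : BVec m →ₗ[ZMod 2] BVec m)) (fun x => f (A x) + h x) := by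
  have hA : ∀ z u, A (z + u) = A z + A.linear u := fun z u => by
    rw [add_comm z u, add_comm (A z)]; exact A.map_vadd z u
  have hh : ∀ z u, h (z + u) = h z + h.linear u := fun z u => by
    rw [add_comm z u, add_comm (h z)]; exact h.map_vadd z u
  refine ⟨fun u hu v hv z => ?_, fun z z' hz => ?_⟩
  · have := hf.1 _ hu _ hv (A z)
    simp only [hA, hh, LinearEquiv.coe_coe] at this ⊢
    linear_combination this
  · have key : A z - A z' ∈ V := by
      refine hf.2 _ _ fun u hu => ?_
      have := hz (A.linear.symm u) (by simpa using hu)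
      simp only [hA, hh, LinearEquiv.apply_symm_apply] at this
      linear_combination this
    have e : A z = A z' + A.linear (z - z') := by rw [← hA]; simp
    rw [e] at key
    simpa using key

lemma IsMFWith.comp_linearEquiv {m : ℕ} {V : Submodule (ZMod 2) (BVec m)} {f : BoolFun m}
    (hf : IsMFWith V f) (e : BVec m ≃ₗ[ZMod 2] BVec m) :
    IsMFWith (V.comap (e : BVec m →ₗ[ZMod 2] BVec m)) (fun x => f (e x)) := by
  have := hf.comp_add e.toAffineEquiv 0
  simp only [AffineMap.coe_zero, Pi.zero_apply, add_zero] at this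
  exact this

/-! ### The standard subspace and the class `MF n` -/

/-- The projection `(x, y) ↦ y` as a linear map. -/
def secondHalfLin (n : ℕ) : BVec (n + n) →ₗ[ZMod 2] BVec n :=
  LinearMap.funLeft (ZMod 2) (ZMod 2) (Fin.natAdd n)

/-- The embedding `x ↦ (x, 0)`. -/
def inFirst (n : ℕ) : BVec n →ₗ[ZMod 2] BVec (n + n) where
  toFun x := Fin.append x 0
  map_add' x y := by
    ext i; refine Fin.addCases (fun i => ?_) (fun i => ?_) i <;>
      simp [-Fin.natAdd_eq_addNat]
  map_smul' c x := by
    ext i; refine Fin.addCases (fun i => ?_) (fun i => ?_) i <;>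
      simp [-Fin.natAdd_eq_addNat]

/-- The embedding `y ↦ (0, y)`. -/
def inSecond (n : ℕ) : BVec n →ₗ[ZMod 2] BVec (n + n) where
  toFun x := Fin.append 0 x
  map_add' x y := by
    ext i; refine Fin.addCases (fun i => ?_) (fun i => ?_) i <;>
      simp [-Fin.natAdd_eq_addNat]
  map_smul' c x := by
    ext i; refine Fin.addCases (fun i => ?_) (fun i => ?_) i <;>
      simp [-Fin.natAdd_eq_addNat]

/-- The subspace `𝔽₂ⁿ × 0`. -/
def stdSub (n : ℕ) : Submodule (ZMod 2) (BVec (n + n)) := LinearMap.ker (secondHalfLin n)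

section halves
variable {n : ℕ} (x y : BVec n) (z w : BVec (n + n))

@[simp] lemma firstHalf_add : firstHalf (z + w) = firstHalf z + firstHalf w := rfl
@[simp] lemma secondHalf_add : secondHalf (z + w) = secondHalf z + secondHalf w := rfl
@[simp] lemma secondHalf_sub : secondHalf (z - w) = secondHalf z - secondHalf w := rfl
@[simp] lemma firstHalf_inFirst : firstHalf (inFirst n x) = x := by
  ext i; simp [firstHalf, inFirst, -Fin.natAdd_eq_addNat]
@[simp] lemma secondHalf_inFirst : secondHalf (inFirst n x) = 0 := by
  ext i; simp [secondHalf, inFirst, -Fin.natAdd_eq_addNat]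
@[simp] lemma firstHalf_inSecond : firstHalf (inSecond n y) = 0 := by
  ext i; simp [firstHalf, inSecond, -Fin.natAdd_eq_addNat]
@[simp] lemma secondHalf_inSecond : secondHalf (inSecond n y) = y := by
  ext i; simp [secondHalf, inSecond, -Fin.natAdd_eq_addNat]
lemma inFirst_add_inSecond : inFirst n (firstHalf z) + inSecond n (secondHalf z) = z := by
  ext i; refine Fin.addCases (fun i => ?_) (fun i => ?_) i <;>
    simp [firstHalf, secondHalf, inFirst, inSecond, -Fin.natAdd_eq_addNat]
@[simp] lemma secondHalfLin_apply : secondHalfLin n z = secondHalf z := rfl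
lemma mem_stdSub : z ∈ stdSub n ↔ secondHalf z = 0 := Iff.rfl
lemma inFirst_mem_stdSub : inFirst n x ∈ stdSub n := by simp [mem_stdSub]
lemma inFirst_injective : Function.Injective (inFirst n) := fun a b h => by
  simpa using congrArg firstHalf h
lemma inFirst_firstHalf (hz : z ∈ stdSub n) : inFirst n (firstHalf z) = z := by
  have := inFirst_add_inSecond z
  rw [mem_stdSub] at hz
  simpa [hz] using this
lemma range_inFirst : LinearMap.range (inFirst n) = stdSub n :=
  le_antisymm (by rintro _ ⟨x, rfl⟩; exact inFirst_mem_stdSub x)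
    fun z hz => ⟨firstHalf z, inFirst_firstHalf z hz⟩
lemma finrank_stdSub : Module.finrank (ZMod 2) (stdSub n) = n := by
  rw [← range_inFirst, LinearMap.finrank_range_of_inj inFirst_injective]; simp

end halves

/-- The function `(x, y) ↦ ⟨x, π(y)⟩ + φ(y)`. -/
def mfFun {n : ℕ} (π : Equiv.Perm (BVec n)) (φ : BoolFun n) : BoolFun (n + n) :=
  fun z => firstHalf z ⬝ᵥ π (secondHalf z) + φ (secondHalf z)

lemma mem_MF {n : ℕ} {f : BoolFun (n + n)} : f ∈ MF n ↔ ∃ π φ, f = mfFun π φ := by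
  simp only [MF, Set.mem_ofPred_eq, funext_iff, mfFun]

lemma mfFun_injective {n : ℕ} :
    Function.Injective (fun p : Equiv.Perm (BVec n) × BoolFun n => mfFun p.1 p.2) := by
  rintro ⟨π, φ⟩ ⟨π', φ'⟩ h
  have hφ : φ = φ' := by
    ext y; simpa [mfFun] using congrFun h (inSecond n y)
  subst hφ
  have hπ : π = π' := by
    ext y : 1
    refine dotProduct_eq _ _ fun x => ?_
    have := congrFun h (inFirst n x + inSecond n y)
    simp only [mfFun] at this
    rw [dotProduct_comm, dotProduct_comm _ x]
    simpa using this
  rw [hπ]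

lemma isMFWith_mfFun {n : ℕ} (π : Equiv.Perm (BVec n)) (φ : BoolFun n) :
    IsMFWith (stdSub n) (mfFun π φ) := by
  refine ⟨fun u hu v hv z => ?_, fun z z' h => ?_⟩
  · rw [mem_stdSub] at hu hv
    simp only [mfFun, firstHalf_add, secondHalf_add, hu, hv, add_zero, add_dotProduct]
    ring
  · rw [mem_stdSub, secondHalf_sub, sub_eq_zero]
    apply π.injective
    refine dotProduct_eq _ _ fun x => ?_
    have := h _ (inFirst_mem_stdSub x)
    simp only [mfFun, firstHalf_add, secondHalf_add, firstHalf_inFirst, secondHalf_inFirst,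
      add_zero, add_dotProduct] at this
    rw [dotProduct_comm, dotProduct_comm _ x]
    linear_combination this

/-- For fixed y, additivity of x ↦ f(x,y) - f(0,y) makes it a dot product with some p(y). Distinct
linear parts on distinct cosets make p injective, hence a permutation by finiteness. -/
lemma IsMFWith.mem_MF {n : ℕ} {f : BoolFun (n + n)} (hf : IsMFWith (stdSub n) f) : f ∈ MF n := by
  have hadd : ∀ y a b, f (inFirst n (a + b) + inSecond n y) - f (inSecond n y) =
      (f (inFirst n a + inSecond n y) - f (inSecond n y)) +
      (f (inFirst n b + inSecond n y) - f (inSecond n y)) := fun y a b => by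
    have := hf.1 _ (inFirst_mem_stdSub a) _ (inFirst_mem_stdSub b) (inSecond n y)
    rw [map_add, show inFirst n a + inFirst n b + inSecond n y =
      inSecond n y + inFirst n a + inFirst n b by abel, add_comm (inFirst n a),
      add_comm (inFirst n b)]
    linear_combination this
  let L : BVec n → (BVec n →ₗ[ZMod 2] ZMod 2) := fun y =>
    (AddMonoidHom.mk' (fun a => f (inFirst n a + inSecond n y) - f (inSecond n y))
      (hadd y)).toZModLinearMap 2
  let p : BVec n → BVec n := fun y i => L y (Pi.single i 1)
  have hL : ∀ y a, f (inFirst n a + inSecond n y) - f (inSecond n y) = a ⬝ᵥ p y := fun y a => by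
    change L y a = _
    rw [(L y).pi_apply_eq_sum_univ a]
    simp only [dotProduct, p, smul_eq_mul]
    refine Finset.sum_congr rfl fun i _ => ?_
    congr 2
    ext j
    simp [Pi.single_apply, eq_comm]
  have hp : Function.Injective p := fun y y' h => by
    have := hf.2 (inSecond n y) (inSecond n y') fun u hu => by
      rw [← inFirst_firstHalf u hu, add_comm, add_comm (inSecond n y'), hL, hL, h]
    simpa [mem_stdSub, sub_eq_zero] using this
  refine ⟨Equiv.ofBijective p (Finite.injective_iff_bijective.mp hp),
    fun y => f (inSecond n y), fun z => ?_⟩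
  have := hL (secondHalf z) (firstHalf z)
  rw [inFirst_add_inSecond] at this
  simp only [Equiv.ofBijective_apply]
  linear_combination this

lemma setOf_isMFWith_stdSub (n : ℕ) : {f | IsMFWith (stdSub n) f} = MF n := by
  ext f
  refine ⟨IsMFWith.mem_MF, fun hf => ?_⟩
  obtain ⟨π, φ, rfl⟩ := MaioranaMcFarland.mem_MF.mp hf
  exact isMFWith_mfFun π φ

/-! ### The completed class as a union over n-dimensional subspaces -/

lemma exists_linearEquiv_comap_eq {K E : Type*} [Field K] [AddCommGroup E] [Module K E]
    [FiniteDimensional K E] (V W : Submodule K E)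
    (h : Module.finrank K V = Module.finrank K W) :
    ∃ e : E ≃ₗ[K] E, V.comap (e : E →ₗ[K] E) = W := by
  obtain ⟨e, he⟩ := Submodule.exists_linearEquiv_restrict_eq
    (LinearEquiv.ofFinrankEq W V h.symm)
  refine ⟨e, ?_⟩
  ext x
  rw [Submodule.mem_comap, LinearEquiv.coe_coe]
  refine ⟨fun hx => ?_, fun hx => ?_⟩
  · obtain ⟨w, hw⟩ := (LinearEquiv.ofFinrankEq W V h.symm).surjective ⟨e x, hx⟩
    have : e w = e x := by rw [← he, hw]
    rw [← e.injective this]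
    exact w.2
  · rw [← he ⟨x, hx⟩]
    exact SetLike.coe_mem _

/-- The finite set of `n`-dimensional subspaces of `𝔽₂²ⁿ`. -/
noncomputable def grass (n : ℕ) : Finset (Submodule (ZMod 2) (BVec (n + n))) :=
  (Set.toFinite {V : Submodule (ZMod 2) (BVec (n + n)) | Module.finrank (ZMod 2) V = n}).toFinset

lemma mem_grass {n : ℕ} {V : Submodule (ZMod 2) (BVec (n + n))} :
    V ∈ grass n ↔ Module.finrank (ZMod 2) V = n := by
  simp [grass]

/-- The finite set of functions that are Maiorana--McFarland with respect to `V`. -/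
noncomputable def mfSet {m : ℕ} (V : Submodule (ZMod 2) (BVec m)) : Finset (BoolFun m) :=
  (Set.toFinite {f | IsMFWith V f}).toFinset

lemma mem_mfSet {m : ℕ} {V : Submodule (ZMod 2) (BVec m)} {f : BoolFun m} :
    f ∈ mfSet V ↔ IsMFWith V f := by
  simp [mfSet]

lemma comap_comap_symm {m : ℕ} (V : Submodule (ZMod 2) (BVec m)) (e : BVec m ≃ₗ[ZMod 2] BVec m) :
    (V.comap (e : BVec m →ₗ[ZMod 2] BVec m)).comap (e.symm : BVec m →ₗ[ZMod 2] BVec m) = V := by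
  ext x; simp

lemma isMFWith_comp_iff {m : ℕ} {V : Submodule (ZMod 2) (BVec m)} {f : BoolFun m}
    (e : BVec m ≃ₗ[ZMod 2] BVec m) :
    IsMFWith (V.comap (e : BVec m →ₗ[ZMod 2] BVec m)) (fun x => f (e x)) ↔ IsMFWith V f := by
  refine ⟨fun h => ?_, fun h => h.comp_linearEquiv e⟩
  have := h.comp_linearEquiv e.symm
  rw [comap_comap_symm] at this
  simpa using this

lemma card_mfSet_inter_comap {m : ℕ} (V W : Submodule (ZMod 2) (BVec m))
    (e : BVec m ≃ₗ[ZMod 2] BVec m) :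
    (mfSet (V.comap (e : BVec m →ₗ[ZMod 2] BVec m)) ∩
      mfSet (W.comap (e : BVec m →ₗ[ZMod 2] BVec m))).card = (mfSet V ∩ mfSet W).card := by
  symm
  refine Finset.card_equiv (Equiv.arrowCongr e.symm.toEquiv (Equiv.refl _)) fun f => ?_
  have : Equiv.arrowCongr e.symm.toEquiv (Equiv.refl _) f = fun x => f (e x) := rfl
  rw [this]
  simp only [Finset.mem_inter, mem_mfSet, isMFWith_comp_iff]

lemma card_mfSet {n : ℕ} {V : Submodule (ZMod 2) (BVec (n + n))} (hV : V ∈ grass n) :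
    (mfSet V).card = (MF n).ncard := by
  obtain ⟨e, he⟩ := exists_linearEquiv_comap_eq (stdSub n) V
    (by rw [finrank_stdSub, mem_grass.mp hV])
  have := card_mfSet_inter_comap (stdSub n) (stdSub n) e
  rw [he, Finset.inter_self, Finset.inter_self] at this
  rw [this, ← setOf_isMFWith_stdSub, mfSet, Set.ncard_eq_toFinset_card _ (Set.toFinite _)]

lemma MFC_eq (n : ℕ) : MFC n = ((grass n).biUnion mfSet : Finset (BoolFun (n + n))) := by
  ext g
  simp only [MFC, Set.mem_ofPred_eq, Finset.coe_biUnion, Set.mem_iUnion, Finset.mem_coe, mem_mfSet]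
  constructor
  · rintro ⟨f, hf, A, h, hg⟩
    rw [← setOf_isMFWith_stdSub] at hf
    refine ⟨_, ?_, (funext hg : g = _) ▸ IsMFWith.comp_add hf A h⟩
    rw [mem_grass]
    have : (stdSub n).comap (A.linear : BVec (n + n) →ₗ[ZMod 2] BVec (n + n)) =
        (stdSub n).map (A.linear.symm : BVec (n + n) →ₗ[ZMod 2] BVec (n + n)) :=
      Submodule.comap_equiv_eq_map_symm _ _
    rw [this, LinearEquiv.finrank_map_eq, finrank_stdSub]
  · rintro ⟨V, hV, hg⟩
    obtain ⟨e, he⟩ := exists_linearEquiv_comap_eq V (stdSub n)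
      (by rw [finrank_stdSub, mem_grass.mp hV])
    have := hg.comp_linearEquiv e
    rw [he] at this
    exact ⟨_, this.mem_MF, e.symm.toAffineEquiv, 0, fun x => by simp⟩

/-! ### Counting n-dimensional subspaces -/

lemma card_linearIndependent_span_eq {n : ℕ} {V : Submodule (ZMod 2) (BVec (n + n))}
    (hV : V ∈ grass n) :
    Nat.card {s : Fin n → BVec (n + n) //
      LinearIndependent (ZMod 2) s ∧ Submodule.span (ZMod 2) (Set.range s) = V} =
      ∏ i : Fin n, (2 ^ n - 2 ^ (i : ℕ)) := by
  have hr := mem_grass.mp hV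
  have := card_linearIndependent (K := ZMod 2) (V := V) (k := n) hr.ge
  rw [hr, ZMod.card] at this
  rw [← this]
  refine Nat.card_congr ⟨fun s => ⟨fun i => ⟨s.1 i, s.2.2.le (Submodule.subset_span ⟨i, rfl⟩)⟩,
    ?_⟩, fun s => ⟨fun i => s.1 i, ?_, ?_⟩, fun s => rfl, fun s => rfl⟩
  · exact LinearIndependent.of_comp V.subtype s.2.1
  · exact s.2.map' V.subtype (Submodule.ker_subtype V)
  · have h : LinearIndependent (ZMod 2) (fun i => (s.1 i : BVec (n + n))) :=
      s.2.map' V.subtype (Submodule.ker_subtype V)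
    refine Submodule.eq_of_le_of_finrank_eq ?_ ?_
    · rw [Submodule.span_le]; rintro _ ⟨i, rfl⟩; exact (s.1 i).2
    · rw [finrank_span_eq_card h, hr, Fintype.card_fin]

/-- Double counting of linearly independent n-tuples, grouped by their span. -/
lemma card_grass_mul (n : ℕ) :
    (grass n).card * ∏ i : Fin n, (2 ^ n - 2 ^ (i : ℕ)) =
      ∏ i : Fin n, (2 ^ (2 * n) - 2 ^ (i : ℕ)) := by
  have h := card_linearIndependent (K := ZMod 2) (V := BVec (n + n)) (k := n) (by simp)
  rw [ZMod.card, Module.finrank_fin_fun] at h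
  rw [two_mul, ← h]
  classical
  let S : Finset (Fin n → BVec (n + n)) := {s | LinearIndependent (ZMod 2) s}
  have hmap : ∀ s ∈ S, Submodule.span (ZMod 2) (Set.range s) ∈ grass n := fun s hs => by
    rw [mem_grass, finrank_span_eq_card (Finset.mem_filter.mp hs).2, Fintype.card_fin]
  have hS := Finset.card_eq_sum_card_fiberwise hmap
  rw [Finset.sum_congr rfl (g := fun _ => ∏ i : Fin n, (2 ^ n - 2 ^ (i : ℕ)))] at hS
  · rw [Finset.sum_const, smul_eq_mul] at hS
    rw [← hS]
    exact (Nat.subtype_card S fun s => by simp [S]).symm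
  · intro V hV
    rw [← card_linearIndependent_span_eq hV]
    exact (Nat.subtype_card _ fun s => by simp [S]).symm

lemma card_grass (n : ℕ) : ((grass n).card : ℝ) = gaussBinom (2 * n) n := by
  have hpos : ∀ i ∈ Finset.range n, (0 : ℝ) < 2 ^ n - 2 ^ i := fun i hi =>
    sub_pos.mpr (pow_lt_pow_right₀ one_lt_two (Finset.mem_range.mp hi))
  rw [gaussBinom, Finset.prod_div_distrib, eq_div_iff (Finset.prod_pos hpos).ne']
  have := congrArg (Nat.cast (R := ℝ)) (card_grass_mul n)
  rw [Finset.prod_range, Finset.prod_range]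
  push_cast at this
  convert this using 2
  · refine Finset.prod_congr rfl fun i _ => ?_
    rw [Nat.cast_sub (Nat.pow_le_pow_right two_pos i.2.le)]; simp
  · rw [Nat.cast_sub (Nat.pow_le_pow_right two_pos (by omega))]; simp

lemma gaussBinom_le (n : ℕ) : gaussBinom (2 * n) n ≤ 2 ^ (2 * n ^ 2) := by
  have : ∀ i ∈ Finset.range n, ((2 : ℝ) ^ (2 * n) - 2 ^ i) / (2 ^ n - 2 ^ i) ≤ 2 ^ (2 * n) :=
    fun i hi => by
      have hi := Finset.mem_range.mp hi
      have h1 : (1 : ℝ) ≤ 2 ^ n - 2 ^ i := by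
        have : (2 : ℝ) ^ (i + 1) ≤ 2 ^ n := pow_le_pow_right₀ one_le_two hi
        have h2 : (1 : ℝ) ≤ 2 ^ i := one_le_pow₀ one_le_two
        rw [pow_succ] at this
        linarith
      refine div_le_of_le_mul₀ (by linarith) (by positivity) ?_
      have h3 : (0 : ℝ) < 2 ^ (2 * n) := by positivity
      have h4 : (0 : ℝ) < 2 ^ i := by positivity
      nlinarith
  refine (Finset.prod_le_prod (fun i hi => ?_) this).trans_eq ?_
  · have hi := Finset.mem_range.mp hi
    refine div_nonneg (sub_nonneg.mpr ?_) (sub_nonneg.mpr ?_) <;>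
    exact pow_le_pow_right₀ one_le_two (by omega)
  · rw [Finset.prod_const, Finset.card_range, ← pow_mul]
    ring_nf

/-! ### Pairwise intersections -/

/-- Composing π ∈ P with a permutation σ of E keeps the values of π off E, so π, and then σ, can be
recovered from π∘σ. -/
lemma card_perm_mul_factorial_le {α : Type*} [Fintype α] [DecidableEq α]
    (P : Finset (Equiv.Perm α)) (E : Finset α)
    (hP : ∀ π ∈ P, ∀ π' ∈ P, (∀ x ∉ E, π x = π' x) → π = π') :
    P.card * E.card.factorial ≤ (Fintype.card α).factorial := by
  rw [← Fintype.card_perm (α := α), ← Fintype.card_coe E, ← Fintype.card_perm (α := E),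
    ← Finset.card_univ, ← Finset.card_univ, ← Finset.card_product]
  refine Finset.card_le_card_of_injOn
    (fun p : Equiv.Perm α × Equiv.Perm E => p.1 * Equiv.Perm.ofSubtype p.2)
    (fun _ _ => Finset.mem_coe.mpr (Finset.mem_univ _)) ?_
  rintro ⟨π, σ⟩ h ⟨π', σ'⟩ h' he
  simp only [Finset.coe_product, Set.mem_prod, Finset.mem_coe] at h h' he
  have hπ : π = π' := hP π h.1 π' h'.1 fun x hx => by
    have := congrArg (fun τ : Equiv.Perm α => τ x) he
    simpa [Equiv.Perm.ofSubtype_apply_of_not_mem _ hx] using this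
  subst hπ
  rw [Equiv.Perm.ofSubtype_injective (mul_left_cancel he)]

lemma exists_transversal {n : ℕ} (Y : Submodule (ZMod 2) (BVec n)) :
    ∃ E : Finset (BVec n), (∀ y ∈ E, ∀ d ∈ Y, d ≠ 0 → y + d ∉ E) ∧
      E.card * 2 ^ Module.finrank (ZMod 2) Y = 2 ^ n := by
  classical
  have : Fintype (BVec n ⧸ Y) := Fintype.ofFinite _
  refine ⟨Finset.univ.image (fun q : BVec n ⧸ Y => Quotient.out q), ?_, ?_⟩
  · intro y hy d hd hd0 hyd
    obtain ⟨q, -, rfl⟩ := Finset.mem_image.mp hy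
    obtain ⟨q', -, hq'⟩ := Finset.mem_image.mp hyd
    have h1 : Submodule.Quotient.mk (p := Y) (Quotient.out q) = q := Quotient.out_eq q
    have h2 : Submodule.Quotient.mk (p := Y) (Quotient.out q') = q' := Quotient.out_eq q'
    have h3 : q' = q := by
      rw [← h2, hq', Submodule.Quotient.mk_add, (Submodule.Quotient.mk_eq_zero Y).mpr hd,
        add_zero, h1]
    rw [h3] at hq'
    exact hd0 (by simpa using hq')
  · have hinj : Function.Injective (fun q : BVec n ⧸ Y => Quotient.out q) :=
      fun _ _ h => Quotient.out_injective h
    rw [Finset.card_image_of_injective _ hinj, Finset.card_univ,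
      Module.card_eq_pow_finrank (K := ZMod 2), ZMod.card, ← pow_add,
      Submodule.finrank_quotient_add_finrank, Module.finrank_fin_fun]

section derivatives
variable {n : ℕ} {W : Submodule (ZMod 2) (BVec (n + n))} {π : Equiv.Perm (BVec n)} {φ : BoolFun n}

/-- Comparing the condition at (x, y) and (0, y) cancels φ and leaves x paired with the second
derivative of π. -/
lemma IsMFWith.second_derivative_eq_zero (h : IsMFWith W (mfFun π φ)) {c c' : BVec n}
    (hc : c ∈ W.map (secondHalfLin n)) (hc' : c' ∈ W.map (secondHalfLin n)) (y : BVec n) :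
    π (y + c + c') - π (y + c) - π (y + c') + π y = 0 := by
  obtain ⟨u, hu, rfl⟩ := hc
  obtain ⟨v, hv, rfl⟩ := hc'
  refine dotProduct_eq_zero _ fun x => ?_
  have h1 := h.1 u hu v hv (inFirst n x + inSecond n y)
  have h2 := h.1 u hu v hv (inSecond n y)
  simp only [mfFun, firstHalf_add, secondHalf_add, firstHalf_inFirst, secondHalf_inFirst,
    firstHalf_inSecond, secondHalf_inSecond, zero_add, add_zero, add_dotProduct,
    zero_dotProduct] at h1 h2
  rw [dotProduct_comm]
  simp only [secondHalfLin_apply, dotProduct_add, dotProduct_sub]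
  linear_combination h1 - h2

lemma IsMFWith.dotProduct_derivative_eq_zero (h : IsMFWith W (mfFun π φ)) {a c : BVec n}
    (ha : inFirst n a ∈ W) (hc : c ∈ W.map (secondHalfLin n)) (y : BVec n) :
    a ⬝ᵥ (π (y + c) - π y) = 0 := by
  obtain ⟨u, hu, rfl⟩ := hc
  have h1 := h.1 u hu _ ha (inSecond n y)
  simp only [mfFun, firstHalf_add, secondHalf_add, firstHalf_inFirst, secondHalf_inFirst,
    firstHalf_inSecond, secondHalf_inSecond, zero_add, add_zero, add_dotProduct,
    zero_dotProduct] at h1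
  simp only [secondHalfLin_apply, dotProduct_sub]
  linear_combination h1

end derivatives

/-- Over 𝔽₂ a hyperplane has exactly one nonzero normal vector, because a functional is determined
by its kernel. -/
lemma eq_of_orthogonal_hyperplane {n : ℕ} {U : Submodule (ZMod 2) (BVec n)}
    (hU : n ≤ Module.finrank (ZMod 2) U + 1) {s t : BVec n} (hs : s ≠ 0) (ht : t ≠ 0)
    (hsU : ∀ a ∈ U, a ⬝ᵥ s = 0) (htU : ∀ a ∈ U, a ⬝ᵥ t = 0) : s = t := by
  let l : BVec n → (BVec n →ₗ[ZMod 2] ZMod 2) := fun s => (dotProductBilin (ZMod 2) (ZMod 2)).flip s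
  have hl : ∀ s a, l s a = a ⬝ᵥ s := fun s a => rfl
  have key : ∀ s, s ≠ 0 → (∀ a ∈ U, a ⬝ᵥ s = 0) → U = LinearMap.ker (l s) := fun s hs hsU => by
    refine Submodule.eq_of_le_of_finrank_le (fun a ha => hsU a ha) ?_
    have hne : LinearMap.ker (l s) ≠ ⊤ := fun htop => hs <| dotProduct_eq_zero _ fun a => by
      rw [dotProduct_comm, ← hl, LinearMap.ker_eq_top.mp htop]; rfl
    have := Submodule.finrank_lt hne
    rw [Module.finrank_fin_fun] at this
    omega
  have hker := (key s hs hsU).symm.trans (key t ht htU)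
  refine dotProduct_eq _ _ fun a => ?_
  rw [dotProduct_comm, dotProduct_comm t]
  have hiff : a ⬝ᵥ s = 0 ↔ a ⬝ᵥ t = 0 := by
    rw [← hl, ← hl, ← LinearMap.mem_ker, ← LinearMap.mem_ker, hker]
  generalize a ⬝ᵥ s = p at *
  generalize a ⬝ᵥ t = q at *
  revert p q
  decide

lemma finrank_comap_inFirst {n : ℕ} (W : Submodule (ZMod 2) (BVec (n + n))) :
    Module.finrank (ZMod 2) (W.map (secondHalfLin n)) +
      Module.finrank (ZMod 2) (W.comap (inFirst n)) = Module.finrank (ZMod 2) W := by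
  rw [← LinearMap.finrank_range_add_finrank_ker ((secondHalfLin n).domRestrict W),
    LinearMap.range_domRestrict]
  congr 1
  rw [(Submodule.equivMapOfInjective _ inFirst_injective _).finrank_eq,
    ← Submodule.finrank_map_subtype_eq, LinearMap.ker_domRestrict, Submodule.map_comap_subtype,
    Submodule.map_comap_eq, range_inFirst, inf_comm, stdSub]

/-- E is a transversal of a line or plane inside the projection of `W`, so every other point of the
coset of y ∈ E lies off E. -/
lemma exists_determining_set {n : ℕ} {W : Submodule (ZMod 2) (BVec (n + n))}
    (hW : W ∈ grass n) (hne : W ≠ stdSub n) :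
    ∃ E : Finset (BVec n), 2 ^ (n - 2) ≤ E.card ∧
      ∀ π π' φ φ', IsMFWith W (mfFun π φ) → IsMFWith W (mfFun π' φ') →
        (∀ x ∉ E, π x = π' x) → π = π' := by
  have hWr := mem_grass.mp hW
  have hYpos : W.map (secondHalfLin n) ≠ ⊥ := fun h => hne <| by
    refine Submodule.eq_of_le_of_finrank_eq ?_ (by rw [hWr, finrank_stdSub])
    exact fun z hz => (Submodule.mem_bot _).mp (h ▸ Submodule.mem_map_of_mem hz)
  obtain ⟨c, hc, hc0⟩ := Submodule.exists_mem_ne_zero_of_ne_bot hYpos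
  have hcard : ∀ {e k : ℕ}, k ≤ 2 → e * 2 ^ k = 2 ^ n → 2 ^ (n - 2) ≤ e := fun {e k} hk h => by
    have hpos : 0 < 2 ^ n := by positivity
    have he : 0 < e := Nat.pos_of_ne_zero fun h0 => by
      rw [h0, zero_mul] at h; omega
    obtain hn | hn := lt_or_ge n 2
    · rw [Nat.sub_eq_zero_of_le hn.le]; exact he
    · have h4 : 2 ^ k ≤ 2 ^ 2 := Nat.pow_le_pow_right two_pos hk
      have h5 : 2 ^ n = 2 ^ (n - 2) * 2 ^ 2 := by rw [← pow_add]; congr 1; omega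
      nlinarith
  -- If the projection is a line, `W` meets `stdSub n` in dimension n - 1, so the nonzero vector
  -- π(y+c) - π(y) is forced. Otherwise the vanishing second derivative gives π(y) from the other
  -- three values on a plane coset.
  by_cases hY : W.map (secondHalfLin n) ≤ Submodule.span (ZMod 2) {c}
  · obtain ⟨E, hE, hEc⟩ := exists_transversal (Submodule.span (ZMod 2) {c})
    have h1 : Module.finrank (ZMod 2) (Submodule.span (ZMod 2) {c}) = 1 := finrank_span_singleton hc0
    refine ⟨E, hcard (by omega) hEc, fun π π' φ φ' h h' heq => Equiv.ext fun y => ?_⟩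
    by_cases hy : y ∈ E
    · have hyc := heq _ (hE y hy c (Submodule.mem_span_singleton_self c) hc0)
      have hU : n ≤ Module.finrank (ZMod 2) (W.comap (inFirst n)) + 1 := by
        have := finrank_comap_inFirst W
        have := Submodule.finrank_mono hY
        omega
      have hder : π (y + c) - π y = π' (y + c) - π' y := by
        refine eq_of_orthogonal_hyperplane hU ?_ ?_
          (fun a ha => h.dotProduct_derivative_eq_zero ha hc y)
          (fun a ha => h'.dotProduct_derivative_eq_zero ha hc y)
        · rw [sub_ne_zero, π.injective.ne_iff]; simpa using hc0
        · rw [sub_ne_zero, π'.injective.ne_iff]; simpa using hc0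
      rw [hyc] at hder
      exact sub_right_injective hder
    · exact heq y hy
  · obtain ⟨c', hc', hcc'⟩ := SetLike.not_le_iff_exists.mp hY
    have hc'0 : c' ≠ 0 := fun h0 => hcc' (h0 ▸ Submodule.zero_mem _)
    have hadd0 : c + c' ≠ 0 := fun h0 => hcc' <| by
      rw [(neg_eq_of_add_eq_zero_right h0).symm]
      exact Submodule.neg_mem _ (Submodule.mem_span_singleton_self c)
    obtain ⟨E, hE, hEc⟩ := exists_transversal (Submodule.span (ZMod 2) {c, c'})
    have hmem : c ∈ Submodule.span (ZMod 2) {c, c'} := Submodule.subset_span (by simp)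
    have hmem' : c' ∈ Submodule.span (ZMod 2) {c, c'} := Submodule.subset_span (by simp)
    have h2 : Module.finrank (ZMod 2) (Submodule.span (ZMod 2) {c, c'}) ≤ 2 := by
      have := finrank_span_finset_le_card (R := ZMod 2) ({c, c'} : Finset (BVec n))
      rw [Set.finrank, Finset.coe_pair] at this
      exact this.trans Finset.card_le_two
    refine ⟨E, hcard h2 hEc, fun π π' φ φ' h h' heq => Equiv.ext fun y => ?_⟩
    by_cases hy : y ∈ E
    · have e1 := heq _ (hE y hy c hmem hc0)
      have e2 := heq _ (hE y hy c' hmem' hc'0)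
      have e3 := heq _ (hE y hy _ (Submodule.add_mem _ hmem hmem') hadd0)
      have d := h.second_derivative_eq_zero hc hc' y
      have d' := h'.second_derivative_eq_zero hc hc' y
      rw [← add_assoc] at e3
      rw [e1, e2, e3, ← d'] at d
      exact add_left_cancel d
    · exact heq y hy

lemma card_mfSet_stdSub_inter_le {n : ℕ} {W : Submodule (ZMod 2) (BVec (n + n))}
    (hW : W ∈ grass n) (hne : W ≠ stdSub n) :
    (mfSet (stdSub n) ∩ mfSet W).card * (2 ^ (n - 2)).factorial ≤
      (2 ^ n).factorial * 2 ^ 2 ^ n := by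
  classical
  obtain ⟨E, hEc, hE⟩ := exists_determining_set hW hne
  let P : Finset (Equiv.Perm (BVec n)) := {π | ∃ φ, IsMFWith W (mfFun π φ)}
  have hP := card_perm_mul_factorial_le P E fun π hπ π' hπ' heq => by
    obtain ⟨φ, h⟩ := (Finset.mem_filter.mp hπ).2
    obtain ⟨φ', h'⟩ := (Finset.mem_filter.mp hπ').2
    exact hE π π' φ φ' h h' heq
  have hsub : mfSet (stdSub n) ∩ mfSet W ⊆
      (P ×ˢ (Finset.univ : Finset (BoolFun n))).image (fun p => mfFun p.1 p.2) := fun f hf => by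
    rw [Finset.mem_inter, mem_mfSet, mem_mfSet] at hf
    obtain ⟨π, φ, rfl⟩ := mem_MF.mp hf.1.mem_MF
    exact Finset.mem_image.mpr ⟨(π, φ), by simpa [P] using ⟨φ, hf.2⟩, rfl⟩
  have hcard : Fintype.card (BVec n) = 2 ^ n := by simp
  have h1 : (mfSet (stdSub n) ∩ mfSet W).card ≤ P.card * 2 ^ 2 ^ n := by
    refine (Finset.card_le_card hsub).trans (Finset.card_image_le.trans_eq ?_)
    rw [Finset.card_product, Finset.card_univ, Fintype.card_fun, hcard, ZMod.card]
  rw [hcard] at hP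
  calc (mfSet (stdSub n) ∩ mfSet W).card * (2 ^ (n - 2)).factorial
      ≤ P.card * 2 ^ 2 ^ n * E.card.factorial :=
        Nat.mul_le_mul h1 (Nat.factorial_le hEc)
    _ = P.card * E.card.factorial * 2 ^ 2 ^ n := by ring
    _ ≤ _ := Nat.mul_le_mul_right _ hP

lemma card_mfSet_inter_le {n : ℕ} {V W : Submodule (ZMod 2) (BVec (n + n))}
    (hV : V ∈ grass n) (hW : W ∈ grass n) (hne : V ≠ W) :
    (mfSet V ∩ mfSet W).card * (2 ^ (n - 2)).factorial ≤ (2 ^ n).factorial * 2 ^ 2 ^ n := by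
  obtain ⟨e, rfl⟩ := exists_linearEquiv_comap_eq (stdSub n) V
    (by rw [finrank_stdSub, mem_grass.mp hV])
  have hW' := comap_comap_symm W e.symm
  rw [LinearEquiv.symm_symm] at hW'
  rw [← hW', card_mfSet_inter_comap]
  refine card_mfSet_stdSub_inter_le ?_ fun h => hne <| by rw [← hW', h]
  rw [mem_grass]
  have : W.comap (e.symm : BVec (n + n) →ₗ[ZMod 2] BVec (n + n)) =
      W.map (e : BVec (n + n) →ₗ[ZMod 2] BVec (n + n)) :=
    (Submodule.map_equiv_eq_comap_symm _ _).symm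
  rw [this, LinearEquiv.finrank_map_eq, mem_grass.mp hW]

/-! ### Bonferroni-type bound and asymptotics -/

/-- The parts of the sets lying in no other set are disjoint; what each set loses is covered by its
pairwise intersections. -/
lemma sum_card_le_card_biUnion_add {ι α : Type*} [DecidableEq ι] [DecidableEq α] (I : Finset ι)
    (S : ι → Finset α) :
    ∑ i ∈ I, (S i).card ≤
      (I.biUnion S).card + ∑ i ∈ I, ∑ j ∈ I.erase i, (S i ∩ S j).card := by
  let T : ι → Finset α := fun i => S i \ (I.erase i).biUnion S
  have hT : ((I : Set ι)).PairwiseDisjoint T := fun i hi j hj hij => by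
    refine Finset.disjoint_left.mpr fun x hx hx' => ?_
    exact (Finset.mem_sdiff.mp hx).2 (Finset.mem_biUnion.mpr
      ⟨j, Finset.mem_erase.mpr ⟨hij.symm, hj⟩, (Finset.mem_sdiff.mp hx').1⟩)
  have h1 : ∑ i ∈ I, (T i).card ≤ (I.biUnion S).card := by
    rw [← Finset.card_biUnion hT]
    exact Finset.card_le_card (Finset.biUnion_mono fun i _ => Finset.sdiff_subset)
  have h2 : ∀ i ∈ I, (S i).card ≤ (T i).card + ∑ j ∈ I.erase i, (S i ∩ S j).card := fun i _ => by
    rw [← Finset.card_sdiff_add_card_inter (S i) ((I.erase i).biUnion S), Finset.inter_biUnion]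
    exact Nat.add_le_add_left Finset.card_biUnion_le _
  calc _ ≤ ∑ i ∈ I, ((T i).card + ∑ j ∈ I.erase i, (S i ∩ S j).card) := Finset.sum_le_sum h2
    _ ≤ _ := by rw [Finset.sum_add_distrib]; exact Nat.add_le_add_right h1 _

lemma ncard_MFC_le (n : ℕ) :
    ((MFC n).ncard : ℝ) ≤ gaussBinom (2 * n) n * ((MF n).ncard : ℝ) := by
  rw [MFC_eq, Set.ncard_coe_finset, ← card_grass]
  exact_mod_cast Finset.card_biUnion_le_card_mul _ _ _ fun V hV => (card_mfSet hV).le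

lemma sub_ncard_MFC_le (n : ℕ) :
    gaussBinom (2 * n) n * ((MF n).ncard : ℝ) - ((MFC n).ncard : ℝ) ≤
      gaussBinom (2 * n) n ^ 2 * (2 ^ 2 ^ n / (2 ^ (n - 2)).factorial) * (2 ^ n).factorial := by
  classical
  have h := sum_card_le_card_biUnion_add (grass n) mfSet
  rw [Finset.sum_congr rfl fun V hV => card_mfSet hV, Finset.sum_const, smul_eq_mul] at h
  have h' : ((grass n).card : ℝ) * (MF n).ncard ≤ (MFC n).ncard +
      ∑ V ∈ grass n, ∑ W ∈ (grass n).erase V, ((mfSet V ∩ mfSet W).card : ℝ) := by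
    rw [MFC_eq, Set.ncard_coe_finset]
    exact_mod_cast h
  set B : ℝ := 2 ^ 2 ^ n / (2 ^ (n - 2)).factorial * (2 ^ n).factorial with hB
  have hB0 : 0 ≤ B := by positivity
  have hf : (0 : ℝ) < (2 ^ (n - 2)).factorial := by exact_mod_cast Nat.factorial_pos _
  have hinner : ∀ V ∈ grass n, ∑ W ∈ (grass n).erase V, ((mfSet V ∩ mfSet W).card : ℝ) ≤
      (grass n).card * B := fun V hV => by
    refine (Finset.sum_le_card_nsmul _ _ B fun W hW => ?_).trans ?_
    · rw [Finset.mem_erase] at hW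
      rw [hB, div_mul_eq_mul_div, le_div_iff₀ hf, mul_comm (2 ^ 2 ^ n : ℝ)]
      exact_mod_cast card_mfSet_inter_le hV hW.2 hW.1.symm
    · rw [nsmul_eq_mul]
      exact mul_le_mul_of_nonneg_right (by exact_mod_cast Finset.card_erase_le) hB0
  have hsum := Finset.sum_le_card_nsmul _ _ _ hinner
  rw [nsmul_eq_mul] at hsum
  rw [← card_grass, mul_assoc, ← hB]
  linarith

lemma factorial_le_ncard_MF (n : ℕ) : (2 ^ n).factorial ≤ (MF n).ncard := by
  have h : ((2 ^ n).factorial : ℕ) = Nat.card (Equiv.Perm (BVec n)) := by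
    simp [Fintype.card_perm]
  rw [h, ← Set.ncard_univ]
  refine Set.ncard_le_ncard_of_injOn (fun π => mfFun π 0) (fun π _ => mem_MF.mpr ⟨π, 0, rfl⟩) ?_
  intro π _ π' _ he
  exact congrArg Prod.fst (mfFun_injective (a₁ := (π, 0)) (a₂ := (π', 0)) he)

lemma one_le_gaussBinom (n : ℕ) : 1 ≤ gaussBinom (2 * n) n := by
  rw [← card_grass]
  exact_mod_cast Finset.card_pos.mpr ⟨stdSub n, mem_grass.mpr (finrank_stdSub (n := n))⟩

lemma tendsto_error :
    Filter.Tendsto (fun n : ℕ => gaussBinom (2 * n) n ^ 2 *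
      (2 ^ 2 ^ n / ((2 ^ (n - 2)).factorial : ℝ))) Filter.atTop (nhds 0) := by
  have hm : Filter.Tendsto (fun n : ℕ => 2 ^ (n - 2)) Filter.atTop Filter.atTop :=
    (tendsto_pow_atTop_atTop_of_one_lt one_lt_two).comp (Filter.tendsto_sub_atTop_nat 2)
  -- With m = 2^(n-2), 256^m = (2^(2^n))²: one factor absorbs the squared Gaussian binomial, the
  -- other counts φ.
  have h := (FloorSemiring.tendsto_pow_div_factorial_atTop (256 : ℝ)).comp hm
  refine squeeze_zero' (Filter.Eventually.of_forall fun n => by positivity) ?_ h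
  filter_upwards [Filter.eventually_ge_atTop 8] with n hn
  -- Equality holds at n = 8, whence the threshold.
  have hsq : 4 * n ^ 2 ≤ 2 ^ n := by
    induction n, hn using Nat.le_induction with
    | base => norm_num
    | succ k hk ih => rw [pow_succ 2 k]; nlinarith
  have h256 : (256 : ℝ) ^ 2 ^ (n - 2) = 2 ^ 2 ^ n * 2 ^ 2 ^ n := by
    have : 2 ^ n = 2 ^ (n - 2) * 2 ^ 2 := by rw [← pow_add]; congr 1; omega
    rw [show (256 : ℝ) = 2 ^ 8 by norm_num, ← pow_mul, ← pow_add, this]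
    congr 1; ring
  have hg : gaussBinom (2 * n) n ^ 2 ≤ 2 ^ 2 ^ n := by
    calc gaussBinom (2 * n) n ^ 2 ≤ (2 ^ (2 * n ^ 2)) ^ 2 :=
          pow_le_pow_left₀ (zero_le_one.trans (one_le_gaussBinom n)) (gaussBinom_le n) 2
      _ = 2 ^ (4 * n ^ 2) := by rw [← pow_mul]; congr 1; ring
      _ ≤ 2 ^ 2 ^ n := pow_le_pow_right₀ one_le_two hsq
  simp only [Function.comp_apply]
  rw [h256, mul_div_assoc]
  exact mul_le_mul_of_nonneg_right hg (by positivity)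

lemma isLittleO_sub_ncard_MFC :
    Asymptotics.IsLittleO Filter.atTop
      (fun n : ℕ => gaussBinom (2 * n) n * ((MF n).ncard : ℝ) - ((MFC n).ncard : ℝ))
      (fun n : ℕ => (Nat.factorial (2 ^ n) : ℝ)) := by
  have h0 : ∀ n : ℕ, ((2 ^ n).factorial : ℝ) ≠ 0 := fun n => by
    exact_mod_cast Nat.factorial_ne_zero _
  rw [Asymptotics.isLittleO_iff_tendsto fun n h => absurd h (h0 n)]
  refine squeeze_zero (fun n => div_nonneg (sub_nonneg.mpr (ncard_MFC_le n)) (by positivity))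
    (fun n => ?_) tendsto_error
  rw [div_le_iff₀ (by positivity)]
  exact sub_ncard_MFC_le n

end MaioranaMcFarland

theorem mainTheorem7 :
    (∀ n : ℕ, ((MaioranaMcFarland.MFC n).ncard : ℝ) ≤
      MaioranaMcFarland.gaussBinom (2 * n) n * ((MaioranaMcFarland.MF n).ncard : ℝ)) ∧
    Asymptotics.IsLittleO Filter.atTop
      (fun n : ℕ =>
        MaioranaMcFarland.gaussBinom (2 * n) n * ((MaioranaMcFarland.MF n).ncard : ℝ) -
          ((MaioranaMcFarland.MFC n).ncard : ℝ))
      (fun n : ℕ => (Nat.factorial (2 ^ n) : ℝ)) ∧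
    Filter.Tendsto
      (fun n : ℕ =>
        ((MaioranaMcFarland.MFC n).ncard : ℝ) /
          (MaioranaMcFarland.gaussBinom (2 * n) n * ((MaioranaMcFarland.MF n).ncard : ℝ)))
      Filter.atTop (nhds 1) := by
  open MaioranaMcFarland in
  refine ⟨ncard_MFC_le, isLittleO_sub_ncard_MFC, ?_⟩
  have hpos : ∀ n : ℕ, (0 : ℝ) < (2 ^ n).factorial := fun n => by
    exact_mod_cast Nat.factorial_pos _
  have hle : ∀ n : ℕ, ((2 ^ n).factorial : ℝ) ≤ gaussBinom (2 * n) n * ((MF n).ncard : ℝ) :=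
    fun n => by
      have h1 : ((2 ^ n).factorial : ℝ) ≤ (MF n).ncard := by exact_mod_cast factorial_le_ncard_MF n
      exact h1.trans (le_mul_of_one_le_left ((hpos n).le.trans h1) (one_le_gaussBinom n))
  have h := isLittleO_sub_ncard_MFC.tendsto_div_nhds_zero
  have h' : Filter.Tendsto (fun n : ℕ =>
      (gaussBinom (2 * n) n * ((MF n).ncard : ℝ) - ((MFC n).ncard : ℝ)) /
        (gaussBinom (2 * n) n * ((MF n).ncard : ℝ))) Filter.atTop (nhds 0) :=
    squeeze_zero
      (fun n => div_nonneg (sub_nonneg.mpr (ncard_MFC_le n)) ((hpos n).le.trans (hle n)))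
      (fun n => div_le_div_of_nonneg_left (sub_nonneg.mpr (ncard_MFC_le n)) (hpos n) (hle n)) h
  have h1 := h'.const_sub 1
  rw [sub_zero] at h1
  refine h1.congr fun n => ?_
  have := ((hpos n).trans_le (hle n)).ne'
  rw [sub_div, div_self this]
  ring
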